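/- **Setting.** A circular robot of radius $R>0$ moves in the plane among obstacle points $\mathcal O\subset\mathbb R^2$; the collision-free region is $M_{\rm free}=\{x:\ \|x-o\|_2\ge R\ \text{for all } o\in\mathcal O\}$, and $\varepsilon>0$ is a fixed raycasting tolerance. The length of a path $\gamma$ (total variation) is $g(\gamma)$. *Corridors.* A gap seen from a point $p$ is given by a short ray in the unit direction $u$, which first hits an obstacle at $p+\Phi_{\rm near}u$, and a long ray in the unit direction $a$, which first hits an obstacle at $p+\Phi_{\rm far}a$, with $\Phi_{\rm near}<\Phi_{\rm far}$ and $\langle u,a\rangle>0$, such that these two endpoints are at distance at least $2R$ and $\Phi_{\rm near}^2-\langle \Phi_{\rm near}u,a\rangle^2<\varepsilon^2$. Let $b$ be the unit vector orthogonal to $a$ with $\langle u,b\rangle<0$. The corridor is $D=M_{\rm free}\cap\{p+\phi a+\psi b:\ 0\le\phi\le\Phi_{\rm near},\ |\psi|\le R\}$, the critical point is $c=p+\Phi_{\rm near}a+Rb$, the edge $\alpha$ is a path of minimal (finite) length from $p$ to $c$ within $D$ (only gaps for which such a path exists are used), and the gap sweeper $\Delta$ is the set of the points $p+\phi a+Rb$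 with $\Phi_{\rm near}\le\phi\le\Phi_{\rm far}$ such that the whole segment from $c$ to this point lies in $M_{\rm free}$. *Topological tree.* The root is $p_{start}$. From each source point $p^i$ of the tree (the root, or a critical point constructed earlier) corridors with critical points $c_k^i$, edges $\alpha_k^i$ and gap sweepers $\Delta_k^i$ are constructed as above. The tree path of a source point or critical point is the concatenation of the edges leading to it from $p_{start}$; $g(p^i)$ and $g(c_k^i)$ denote its length. *Distinguished homotopies.* For a point $m$, the set $\varphi^{-1}([\cdot])$ of paths from $p_{start}$ to $m$ is defined along the tree. For the root it consists of all paths in $M_{\rm free}$ from $p_{start}$ to $m$. For a critical point $c=c_k^i$ it consists of all paths in $M_{\rm free}$ from $p_{start}$ to $m$ that visit $c$ so that the part up to this visit is homotopic in $M_{\rm free}$, with fixed endpoints, to the tree path of $c$, and belongs itself to the distinguished homotopy $[p^i]$ (with endpoint $c$). We write $\min_{\varphi^{-1}([\cdot])}g(m)$ for the minimal length of a path to $m$ in the respective set. **Lemma and Corollary (Comparison between Gap Sweeper and Edge).** Let $p^i,p^j$ be source points of the tree, with corridors $k$ and $l$ constructed from $p^i$ and $p^j$ respectively. Suppose the gap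 sweeper $\Delta_l^j$ and the edge $\alpha_k^i$ meet at $q$, and let $g(q)|_{{\rm from}\ p^i}$ be the length of $\alpha_k^i$ from $p^i$ to $q$. 1. If $g(p^i)+g(q)|_{{\rm from}\ p^i}>g(c_l^j)+\|c_l^j-q\|_2$, then for every $m\in\Delta_k^i$ both minima below exist and $$\min_{\varphi^{-1}([c_l^j])}g(m)<\min_{\varphi^{-1}([c_k^i])}g(m).$$ 2. If $g(c_l^j)>g(p^i)+g(q)|_{{\rm from}\ p^i}+\|q-c_l^j\|_2$, then for every $m\in\Delta_l^j$ both minima below exist and $$\min_{\varphi^{-1}([p^i])}g(m)<\min_{\varphi^{-1}([c_l^j])}g(m).$$ -/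

import Mathlib

open scoped ENNReal unitInterval

noncomputable section

/-- The planar workspace with its Euclidean metric. -/
abbrev Plane : Type := EuclideanSpace ℝ (Fin 2)

/-- Length of a path (total variation, possibly infinite). -/
def pathLength {x y : Plane} (γ : Path x y) : ℝ≥0∞ := eVariationOn γ Set.univ

/-- Length of the part of a path that is traversed up to the parameter `t`. -/
def pathLengthUpTo {x y : Plane} (γ : Path x y) (t : I) : ℝ≥0∞ := eVariationOn γ (Set.Iic t)

/-- Homotopy with fixed endpoints inside the region `M`. -/
def HomotopicIn (M : Set Plane) {x y : Plane} (γ δ : Path x y) : Prop :=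
  ∃ F : Path.Homotopy γ δ, ∀ z, F z ∈ M

/-- A planar environment, given by the set of its obstacle points, together with the radius `R`
of the circular robot and the tolerance `ε` of the raycasting. -/
structure Environment where
  obstacles : Set Plane
  R : ℝ
  R_pos : 0 < R
  ε : ℝ
  ε_pos : 0 < ε

namespace Environment

/-- The collision-free part `M_free`: the positions of the centre of the robot at which its
footprint, an open disc of radius `R`, contains no obstacle point. -/
def free (E : Environment) : Set Plane := {x | ∀ o ∈ E.obstacles, E.R ≤ dist x o}

/-- The ray from `p` with unit direction `u` has length `Φ`: it first hits an obstacle at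
`p + Φ u`. -/
def RayHits (E : Environment) (p u : Plane) (Φ : ℝ) : Prop :=
  ‖u‖ = 1 ∧ 0 ≤ Φ ∧ p + Φ • u ∈ E.obstacles ∧ ∀ t, 0 ≤ t → t < Φ → p + t • u ∉ E.obstacles

/-- A gap seen from `p`: a short ray (direction `u`, length `near`) next to a long ray
(direction `a`, length `far`).  The unit vector `b` is orthogonal to `a` and points to the side of
the long ray that does not contain the short ray (so that the two mirror-symmetric cases are
treated at once).  The endpoints of the two rays are at least `2R` apart, and the endpoint of the
short ray is `ε`-near to the long ray. -/
structure Gap (E : Environment) (p : Plane) where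
  a : Plane
  b : Plane
  u : Plane
  near : ℝ
  far : ℝ
  norm_b : ‖b‖ = 1
  inner_ab : inner ℝ a b = 0
  inner_ua : 0 < inner ℝ u a
  inner_ub : inner ℝ u b < 0
  near_ray : E.RayHits p u near
  far_ray : E.RayHits p a far
  near_lt_far : near < far
  separated : 2 * E.R ≤ dist (p + near • u) (p + far • a)
  close : near ^ 2 - (inner ℝ (near • u) a) ^ 2 < E.ε ^ 2

namespace Gap

variable {E : Environment} {p : Plane}

/-- The corridor `D`: the collision-free part of the rectangle of length `near` and half-width `R`
along the long ray. -/
def corridor (G : E.Gap p) : Set Plane :=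
  {x | x ∈ E.free ∧ ∃ φ ∈ Set.Icc 0 G.near, ∃ ψ ∈ Set.Icc (-E.R) E.R,
    x = p + φ • G.a + ψ • G.b}

/-- The critical point `c`, a corner of the rectangle. -/
def crit (G : E.Gap p) : Plane := p + G.near • G.a + E.R • G.b

/-- The gap sweeper `Δ`: the points reached from the critical point by moving in the direction of
the long ray, up to its end, as long as no collision occurs. -/
def sweeper (G : E.Gap p) : Set Plane :=
  {x | ∃ φ ∈ Set.Icc G.near G.far, x = p + φ • G.a + E.R • G.b ∧
    ∀ φ' ∈ Set.Icc G.near φ, p + φ' • G.a + E.R • G.b ∈ E.free}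

end Gap

/-- A gap for which planning in the corridor has succeeded: `edge` is a shortest path `α` from `p`
to the critical point within the corridor. -/
structure Corridor (E : Environment) (p : Plane) extends E.Gap p where
  edge : Path p toGap.crit
  edge_mem : ∀ t, edge t ∈ toGap.corridor
  edge_finite : pathLength edge ≠ ⊤
  edge_shortest : ∀ β : Path p toGap.crit, (∀ t, β t ∈ toGap.corridor) →
    pathLength edge ≤ pathLength β

/-- The points of the topological tree rooted at `s`, indexed by their position: the root, and the
critical point of each corridor that has been constructed at a point of the tree.  (A critical
point is the source point of the node that arises when it is expanded.) -/
inductive Node (E : Environment) (s : Plane) : Plane → Type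
  | root : Node E s s
  | child {p : Plane} (n : Node E s p) (C : E.Corridor p) : Node E s C.crit

namespace Node

variable {E : Environment} {s : Plane}

/-- The tree path: the concatenation of the edges from the root. -/
def treePath : {p : Plane} → Node E s p → Path s p
  | _, root => Path.refl s
  | _, child n C => n.treePath.trans C.edge

/-- The length `g` of the tree path. -/
def g {p : Plane} (n : Node E s p) : ℝ≥0∞ := pathLength n.treePath

/-- The collision-free paths from `s` to `x` that belong to the distinguished homotopy represented
by a point of the tree.  For the root these are all the collision-free paths.  For a critical point
`c` of a node with source point `p`, they are the collision-free paths that visit `c` so that the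
part up to this visit is homotopic to the tree path of `c` and belongs to the distinguished
homotopy of `p`; what happens after the visit is not restricted. -/
def paths : {p : Plane} → Node E s p → (x : Plane) → Set (Path s x)
  | _, root, _ => {γ | ∀ t, γ t ∈ E.free}
  | _, child n C, _ => {γ | (∀ t, γ t ∈ E.free) ∧ ∃ (t : I) (h : γ t = C.crit),
      let γ' : Path s C.crit := (γ.subpath 0 t).cast γ.source.symm h.symm
      HomotopicIn E.free γ' (child n C).treePath ∧ γ' ∈ n.paths C.crit}

/-- `[n]` beats `[n']` at `x`: the minimal lengths of the paths to `x` in the two distinguished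
homotopies exist, and the one of `[n]` is strictly smaller. -/
def Beats {p p' : Plane} (n : Node E s p) (n' : Node E s p') (x : Plane) : Prop :=
  ∃ L L' : ℝ≥0∞, IsLeast (pathLength '' n.paths x) L ∧ IsLeast (pathLength '' n'.paths x) L' ∧
    L < L'

end Node

end Environment

end

/-! The heart is that an edge, shortest only among paths inside its corridor, is also shortest among
all collision-free paths homotopic to it (`Corridor.pathLength_edge_le`). The corridor is the free
region cut by four half-planes, so it suffices to push a path into one half-plane at a time, without
lengthening it and without leaving the homotopy class (`HomotopicIn.exists_inter_halfPlane`).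

For one half-plane, extend the homotopy to a map on the whole plane and keep it on the component `C`
of the preimage of the half-plane that contains the edge. Each component of the complement of `C`
has a connected frontier, by unicoherence, and this frontier is mapped into the boundary line. The
closure of its image is therefore a point or a segment of free positions, onto which the values on
that component are projected (`exists_fold`). Projection onto a segment is nonexpansive, so lengths
do not grow.

Induction along the tree then shows that a path in a distinguished homotopy has length at least `g`
when it visits the node (`Node.exists_prefix`). Since nothing is required after the visit, the
minimum at `m` is `g` plus the length of a shortest collision-free path to `m`
(`Node.exists_isLeast`). Both claims follow by comparing an explicit detour through `q` with the
lower bound `g` plus straight-line distance. -/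

/-! ### Unicoherence and frontiers of complementary components. -/

/-- Simply connected spaces are unicoherent: the intersection of two connected closed sets that
cover the space is connected. -/
theorem IsPreconnected.inter_of_union_eq_univ {X : Type*} [TopologicalSpace X]
    [SimplyConnectedSpace X] [LocallyPathConnectedSpace X] [NormalSpace X] {A B : Set X}
    (hA : IsClosed A) (hB : IsClosed B) (cA : IsPreconnected A) (cB : IsPreconnected B)
    (hAB : A ∪ B = Set.univ) : IsPreconnected (A ∩ B) := by
  rw [isPreconnected_closed_iff]
  intro t t' ht ht' hsub ⟨x, hx, hxt⟩ ⟨y, hy, hyt⟩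
  by_contra hne
  rw [Set.not_nonempty_iff_eq_empty] at hne
  have hAc : IsClosed (A ∩ B) := hA.inter hB
  obtain ⟨u, hu0, hu1, -⟩ := exists_continuous_zero_one_of_isClosed (hAc.inter ht)
    (hAc.inter ht') (by
      rw [Set.disjoint_left]
      rintro z ⟨hz, hzt⟩ ⟨-, hzt'⟩
      exact (hne ▸ (⟨hz, hzt, hzt'⟩ : z ∈ A ∩ B ∩ (t ∩ t')) : z ∈ (∅ : Set X)))
  classical
  -- If `A ∩ B` split, `f` would run half-way round the circle in one direction on `A` and in the
  -- other on `B`. The formulas agree on `A ∩ B`, where `u` is 0 or 1, because 1/2 and -1/2 coincide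
  -- modulo 1.
  let f : X → AddCircle (1 : ℝ) := fun z => if z ∈ A then ((u z / 2 : ℝ) : AddCircle (1 : ℝ))
    else ((-(u z / 2) : ℝ) : AddCircle (1 : ℝ))
  have hfA : ∀ z ∈ A, f z = ((u z / 2 : ℝ) : AddCircle (1 : ℝ)) := fun z hz => if_pos hz
  have hfB : ∀ z ∈ B, f z = ((-(u z / 2) : ℝ) : AddCircle (1 : ℝ)) := by
    intro z hz
    by_cases hzA : z ∈ A
    · rcases hsub ⟨hzA, hz⟩ with h | h
      · have : u z = 0 := hu0 ⟨⟨hzA, hz⟩, h⟩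
        simp [hfA z hzA, this]
      · have : u z = 1 := hu1 ⟨⟨hzA, hz⟩, h⟩
        rw [hfA z hzA, ← sub_eq_zero, ← AddCircle.coe_sub, AddCircle.coe_eq_zero_iff]
        exact ⟨1, by rw [this]; norm_num⟩
    · exact if_neg hzA
  have hf : Continuous f := by
    rw [← continuousOn_univ, ← hAB]
    refine ContinuousOn.union_of_isClosed ?_ ?_ hA hB
    · refine ContinuousOn.congr (Continuous.continuousOn ?_) hfA
      exact (AddCircle.continuous_mk' 1).comp (by fun_prop)
    · refine ContinuousOn.congr (Continuous.continuousOn ?_) hfB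
      exact (AddCircle.continuous_mk' 1).comp (by fun_prop)
  obtain ⟨θ, ⟨-, hθ⟩, -⟩ := (AddCircle.isCoveringMap_coe (1 : ℝ)).existsUnique_continuousMap_lifts
    ⟨f, hf⟩ x (u x / 2) (hfA x hx.1).symm
  have hθ' : ∀ z, ((θ z : ℝ) : AddCircle (1 : ℝ)) = f z := fun z => congrFun hθ z
  -- Two real lifts of `f` on a connected set differ by a constant integer. From `x` to `y`, the
  -- lift `θ` would thus change by 1/2 according to `A` and by -1/2 according to `B`.
  have key : ∀ (S : Set X) (v : X → ℝ), IsPreconnected S → Continuous v →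
      (∀ z ∈ S, f z = ((v z : ℝ) : AddCircle (1 : ℝ))) → ∀ z ∈ S, ∀ w ∈ S,
      θ z - v z = θ w - v w := by
    intro S v hS hv h z hz w hw
    refine hS.constant_of_mapsTo (T := Set.range ((↑) : ℤ → ℝ)) (f := fun z => θ z - v z) ?_ ?_ ?_ hz hw
    · rw [← Set.image_univ]
      exact IsDiscrete.univ.image Int.isClosedEmbedding_coe_real.isInducing
    · fun_prop
    · intro z hz
      have : ((θ z - v z : ℝ) : AddCircle (1 : ℝ)) = 0 := by
        rw [AddCircle.coe_sub, hθ', h z hz, sub_self]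
      rw [AddCircle.coe_eq_zero_iff] at this
      obtain ⟨n, hn⟩ := this
      exact ⟨n, by simpa using hn⟩
  have h1 := key A _ cA (by fun_prop) hfA x hx.1 y hy.1
  have h2 := key B _ cB (by fun_prop) hfB x hx.2 y hy.2
  have hx0 : u x = 0 := hu0 ⟨hx, hxt⟩
  have hy1 : u y = 1 := hu1 ⟨hy, hyt⟩
  rw [hx0, hy1] at h1 h2
  linarith

/-- By local connectedness, a frontier point outside `C` would have an open component of its own;
this meets, hence equals, the given open component, which contains none of its frontier points. -/
theorem frontier_connectedComponentIn_compl_subset {X : Type*} [TopologicalSpace X]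
    [LocallyConnectedSpace X] {C : Set X} (hC : IsClosed C) (x : X) :
    frontier (connectedComponentIn Cᶜ x) ⊆ C := by
  intro z hz
  by_contra hzC
  have hO := hC.isOpen_compl.connectedComponentIn (x := x)
  have hO' := hC.isOpen_compl.connectedComponentIn (x := z)
  obtain ⟨w, hw1, hw2⟩ := mem_closure_iff.1 (frontier_subset_closure hz) _ hO'
    (mem_connectedComponentIn hzC)
  have e1 := connectedComponentIn_eq hw1
  have e2 := connectedComponentIn_eq hw2
  rw [hO.frontier_eq] at hz
  apply hz.2
  rw [e2, ← e1]
  exact mem_connectedComponentIn hzC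


/-- The boundary of a component of the complement of a connected closed set is connected, in a
simply connected space. -/
theorem isPreconnected_frontier_connectedComponentIn_compl {X : Type*} [TopologicalSpace X]
    [SimplyConnectedSpace X] [LocallyPathConnectedSpace X] [NormalSpace X] {C : Set X}
    (hC : IsClosed C) (cC : IsConnected C) (x : X) :
    IsPreconnected (frontier (connectedComponentIn Cᶜ x)) := by
  obtain ⟨⟨c, hc⟩, cC⟩ := cC
  have hO := hC.isOpen_compl.connectedComponentIn (x := x)
  rw [frontier_eq_closure_inter_closure, hO.isClosed_compl.closure_eq]
  refine IsPreconnected.inter_of_union_eq_univ isClosed_closure hO.isClosed_compl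
    isPreconnected_connectedComponentIn.closure ?_ ?_
  · have hCO : C ⊆ (connectedComponentIn Cᶜ x)ᶜ :=
      Set.subset_compl_comm.1 (connectedComponentIn_subset _ _)
    refine isPreconnected_of_forall c fun y hy => ?_
    by_cases hyC : y ∈ C
    · exact ⟨C, hCO, hc, hyC, cC⟩
    have hyO := mem_connectedComponentIn (F := Cᶜ) hyC
    obtain ⟨z, hz⟩ : (frontier (connectedComponentIn Cᶜ y)).Nonempty :=
      nonempty_frontier_iff.2 ⟨⟨y, hyO⟩, fun h => connectedComponentIn_subset Cᶜ y
        (h ▸ Set.mem_univ c) hc⟩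
    -- Any other component of the complement is attached to `C` through its frontier, so the
    -- complement of the chosen component is connected.
    refine ⟨C ∪ closure (connectedComponentIn Cᶜ y), Set.union_subset hCO ?_, Or.inl hc,
      Or.inr (subset_closure hyO), IsPreconnected.union z
        (frontier_connectedComponentIn_compl_subset hC y hz) (frontier_subset_closure hz) cC
        isPreconnected_connectedComponentIn.closure⟩
    rw [Set.subset_compl_iff_disjoint_right]
    refine Disjoint.closure_left ?_ hO
    rw [Set.disjoint_left]
    intro w h1 h2
    apply hy
    rw [connectedComponentIn_eq h2, ← connectedComponentIn_eq h1]
    exact hyO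
  · exact Set.eq_univ_of_forall fun y => (em _).imp_left fun h => subset_closure h

theorem IsPreconnected.exists_mem_frontier {X : Type*} [TopologicalSpace X] {S O : Set X}
    (hS : IsPreconnected S) {x y : X} (hx : x ∈ S) (hxO : x ∈ O) (hy : y ∈ S) (hyO : y ∉ O) :
    ∃ z ∈ S, z ∈ frontier O := by
  by_contra! h
  have hsub : S ⊆ interior O ∪ interior Oᶜ := by
    intro z hz
    by_contra hzO
    rw [Set.mem_union, not_or, interior_compl, Set.mem_compl_iff, not_not] at hzO
    exact h z hz ⟨hzO.2, hzO.1⟩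
  have hdisj : Disjoint (interior O) (interior Oᶜ) :=
    disjoint_compl_right.mono interior_subset interior_subset
  have hxi : x ∈ interior O := (hsub hx).resolve_right fun h' => interior_subset h' hxO
  exact hyO (interior_subset (hS.subset_left_of_subset_union isOpen_interior isOpen_interior hdisj
    hsub ⟨x, hx, hxi⟩ hy))

/-! ### Folding a homotopy into a half-plane. -/

/-- A compact connected subset of a line is the image of a nonexpansive retraction. -/
theorem exists_nonexpansive_retraction {J : Set Plane} (hJ : IsCompact J) (cJ : IsConnected J)
    {u v : Plane} (hv : ‖v‖ = 1)
    (huv : ∀ x : Plane, x = inner ℝ u x • u + inner ℝ v x • v) {r : ℝ}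
    (hJr : ∀ x ∈ J, inner ℝ u x = r) :
    ∃ ρ : Plane → Plane, (∀ x y, dist (ρ x) (ρ y) ≤ dist x y) ∧ (∀ x, ρ x ∈ J) ∧
      ∀ x ∈ J, ρ x = x := by
  have hcont : Continuous fun x : Plane => inner ℝ v x := by fun_prop
  have hS := eq_Icc_of_connected_compact (cJ.image _ hcont.continuousOn) (hJ.image hcont)
  set S := (fun x : Plane => inner ℝ v x) '' J
  have hle : sInf S ≤ sSup S := by
    have := (cJ.image _ hcont.continuousOn).nonempty
    change S.Nonempty at this
    rw [hS] at this
    exact Set.nonempty_Icc.1 this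
  have hrep : ∀ x ∈ J, x = r • u + inner ℝ v x • v := fun x hx => by
    conv_lhs => rw [huv x, hJr x hx]
  refine ⟨fun x => r • u + (Set.projIcc _ _ hle (inner ℝ v x) : ℝ) • v, fun x y => ?_, fun x => ?_,
    fun x hx => ?_⟩
  · rw [dist_add_left, dist_eq_norm, ← sub_smul, norm_smul, hv, mul_one, Real.norm_eq_abs]
    calc _ ≤ |inner ℝ v x - inner ℝ v y| := by
          have := (LipschitzWith.projIcc hle).dist_le_mul (inner ℝ v x) (inner ℝ v y)
          simpa [Subtype.dist_eq, Real.dist_eq] using this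
      _ = |inner ℝ v (x - y)| := by rw [inner_sub_right]
      _ ≤ ‖v‖ * ‖x - y‖ := abs_real_inner_le_norm _ _
      _ = dist x y := by rw [hv, one_mul, dist_eq_norm]
  · obtain ⟨y, hy, hyx⟩ : (Set.projIcc _ _ hle (inner ℝ v x) : ℝ) ∈ S := by
      exact hS.ge (Subtype.coe_prop (Set.projIcc _ _ hle (inner ℝ v x)))
    change r • u + _ ∈ J
    rw [← hyx]
    exact (hrep y hy) ▸ hy
  · have : inner ℝ v x ∈ Set.Icc (sInf S) (sSup S) := hS ▸ ⟨x, hx, rfl⟩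
    change r • u + (Set.projIcc _ _ hle (inner ℝ v x) : ℝ) • v = x
    rw [Set.projIcc_of_mem hle this]
    exact (hrep x hx).symm

theorem IsClosed.isClosed_connectedComponentIn {X : Type*} [TopologicalSpace X] {A : Set X}
    (hA : IsClosed A) (x : X) : IsClosed (connectedComponentIn A x) := by
  by_cases hx : x ∈ A
  · refine isClosed_of_closure_subset
      (isPreconnected_connectedComponentIn.closure.subset_connectedComponentIn
        (subset_closure (mem_connectedComponentIn hx))
        (closure_minimal (connectedComponentIn_subset _ _) hA))
  · rw [connectedComponentIn_eq_empty hx]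
    exact isClosed_empty

/-- Additivity of variation over consecutive intervals allows a bound weaker than pointwise
nonexpansiveness; the fold provides only this, since distinct components are projected differently.
-/
theorem eVariationOn_le_of_edist_le {α E : Type*} [LinearOrder α] [PseudoEMetricSpace E]
    {f g : α → E} (h : ∀ s s', s ≤ s' → edist (f s) (f s') ≤ eVariationOn g (Set.Icc s s')) :
    eVariationOn f Set.univ ≤ eVariationOn g Set.univ := by
  refine iSup_le fun ⟨n, w, hw, _⟩ => ?_
  calc _ ≤ ∑ i ∈ Finset.range n, eVariationOn g (Set.Icc (w i) (w (i + 1))) :=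
        Finset.sum_le_sum fun i _ => by
          rw [edist_comm]
          exact h _ _ (hw i.le_succ)
    _ = eVariationOn g (Set.Icc (w 0) (w n)) := eVariationOn.sum' g hw
    _ ≤ _ := eVariationOn.mono g (Set.subset_univ _)

/-- A continuous map to the plane is modified on the complement of a connected component of the
preimage of a half-plane, so that its values lie in the half-plane: each component of the
complement is projected onto the part of the boundary line that is covered by the image of its
frontier. -/
theorem exists_fold {X : Type*} [TopologicalSpace X] [SimplyConnectedSpace X]
    [LocallyPathConnectedSpace X] [NormalSpace X] {M : Set Plane} (hM : IsClosed M)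
    {u v : Plane} (hv : ‖v‖ = 1)
    (huv : ∀ x : Plane, x = inner ℝ u x • u + inner ℝ v x • v) (r : ℝ) {F : X → Plane}
    (hF : Continuous F) (hFM : ∀ z, F z ∈ M) {K : Set Plane} (hK : IsCompact K)
    (hFK : ∀ z, F z ∈ K) {x₀ : X} (hx₀ : inner ℝ u (F x₀) ≤ r) {C : Set X}
    (hC : C = connectedComponentIn (F ⁻¹' {x | inner ℝ u x ≤ r}) x₀) :
    ∃ G : X → Plane, Continuous G ∧ (∀ z ∈ C, G z = F z) ∧
      (∀ z, G z ∈ M ∩ {x | inner ℝ u x ≤ r}) ∧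
      ∀ S, IsPreconnected S → ∀ x ∈ S, ∀ y ∈ S, dist (G x) (G y) ≤ dist (F x) (F y) ∨
        ∃ z ∈ S, z ∈ C ∧ dist (G x) (F z) ≤ dist (F x) (F z) := by
  have hH : IsClosed {x : Plane | inner ℝ u x ≤ r} := isClosed_le (by fun_prop) (by fun_prop)
  have hCcl : IsClosed C := hC ▸ (hH.preimage hF).isClosed_connectedComponentIn x₀
  have hCsub : C ⊆ F ⁻¹' {x | inner ℝ u x ≤ r} := hC ▸ connectedComponentIn_subset _ _
  have hCconn : IsConnected C :=
    hC ▸ isConnected_connectedComponentIn_iff.2 hx₀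
  let O : X → Set X := connectedComponentIn Cᶜ
  have hOfr : ∀ x, frontier (O x) ⊆ C := frontier_connectedComponentIn_compl_subset hCcl
  have hline : ∀ x, ∀ z ∈ frontier (O x), inner ℝ u (F z) = r := by
    intro x z hz
    have hzC := hOfr x hz
    refine le_antisymm (hCsub hzC) (not_lt.1 fun hlt => ?_)
    -- A frontier point mapped strictly inside the half-plane would have a connected neighbourhood
    -- contained in `C`, which cannot meet `O x`.
    have hopen : IsOpen {w | inner ℝ u (F w) < r} := isOpen_lt (by fun_prop) (by fun_prop)
    have hN := hopen.connectedComponentIn (x := z)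
    obtain ⟨w, hw, hwO⟩ := mem_closure_iff.1 (frontier_subset_closure hz) _ hN
      (mem_connectedComponentIn (F := {w | inner ℝ u (F w) < r}) hlt)
    refine connectedComponentIn_subset _ _ hwO ?_
    rw [hC, connectedComponentIn_eq (hC ▸ hzC)]
    refine isPreconnected_connectedComponentIn.subset_connectedComponentIn
      (mem_connectedComponentIn (F := {w | inner ℝ u (F w) < r}) hlt)
      ((connectedComponentIn_subset _ _).trans fun w hw => (show inner ℝ u (F w) < r from hw).le) hw
  have hfr : ∀ x, x ∉ C → (frontier (O x)).Nonempty := fun x hx =>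
    nonempty_frontier_iff.2 ⟨⟨x, mem_connectedComponentIn (F := Cᶜ) hx⟩, fun h =>
      let ⟨c, hc⟩ := hCconn.nonempty
      connectedComponentIn_subset Cᶜ x (h ▸ Set.mem_univ c : c ∈ O x) hc⟩
  let J : X → Set Plane := fun x => closure (F '' frontier (O x))
  have hJM : ∀ x, J x ⊆ M ∩ {x | inner ℝ u x ≤ r} := fun x =>
    closure_minimal (by rintro _ ⟨z, hz, rfl⟩; exact ⟨hFM z, hCsub (hOfr x hz)⟩) (hM.inter hH)
  -- The retraction is indexed by the component as a set, so that all points of one component share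
  -- it.
  have hret : ∀ A : Set X, ∃ ρ : Plane → Plane, ∀ x, x ∉ C → O x = A →
      (∀ y z, dist (ρ y) (ρ z) ≤ dist y z) ∧ (∀ y, ρ y ∈ J x) ∧ ∀ y ∈ J x, ρ y = y := by
    intro A
    by_cases hA : ∃ x, x ∉ C ∧ O x = A
    · obtain ⟨x, hxC, rfl⟩ := hA
      have hcompact : IsCompact (J x) := hK.of_isClosed_subset isClosed_closure
        (closure_minimal (by rintro _ ⟨z, -, rfl⟩; exact hFK z) hK.isClosed)
      have hconn : IsConnected (J x) := IsConnected.closure (IsConnected.image ⟨hfr x hxC,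
        isPreconnected_frontier_connectedComponentIn_compl hCcl hCconn x⟩ _ hF.continuousOn)
      have hJr : ∀ y ∈ J x, inner ℝ u y = r := closure_minimal
        (by rintro _ ⟨z, hz, rfl⟩; exact hline x z hz)
        (isClosed_eq (by fun_prop) (by fun_prop) : IsClosed {y : Plane | inner ℝ u y = r})
      obtain ⟨ρ, hρ⟩ := exists_nonexpansive_retraction hcompact hconn hv huv hJr
      exact ⟨ρ, fun y _ hy => by simpa only [J, hy] using hρ⟩
    · exact ⟨id, fun x hx hxA => (hA ⟨x, hx, hxA⟩).elim⟩
  choose ρ hρ using hret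
  classical
  let G : X → Plane := fun z => if z ∈ C then F z else ρ (O z) (F z)
  have hG1 : ∀ z ∈ C, G z = F z := fun z hz => if_pos hz
  have hG2 : ∀ z, z ∉ C → G z = ρ (O z) (F z) := fun z hz => if_neg hz
  have hG3 : ∀ S, IsPreconnected S → ∀ x ∈ S, ∀ y ∈ S, dist (G x) (G y) ≤ dist (F x) (F y) ∨
        ∃ z ∈ S, z ∈ C ∧ dist (G x) (F z) ≤ dist (F x) (F z) := by
    intro S hS x hx y hy
    by_cases hxC : x ∈ C
    · exact Or.inr ⟨x, hx, hxC, by rw [hG1 x hxC]⟩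
    obtain ⟨h1, h2, h3⟩ := hρ _ x hxC rfl
    by_cases hyO : y ∈ O x
    · left
      have hyC : y ∉ C := connectedComponentIn_subset _ _ hyO
      rw [hG2 x hxC, hG2 y hyC, show O y = O x from (connectedComponentIn_eq hyO).symm]
      exact h1 _ _
    -- A connected set leaving `O x` crosses its frontier at a point of `C` whose image is fixed by
    -- the retraction.
    · right
      obtain ⟨z, hz, hzO⟩ := hS.exists_mem_frontier hx
        (mem_connectedComponentIn (F := Cᶜ) hxC) hy hyO
      refine ⟨z, hz, hOfr x hzO, ?_⟩
      have hzJ : F z ∈ J x := subset_closure ⟨z, hzO, rfl⟩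
      rw [hG2 x hxC]
      conv_lhs => rw [← h3 _ hzJ]
      exact h1 _ _
  refine ⟨G, ?_, hG1, fun z => ?_, hG3⟩
  · rw [continuous_iff_continuousAt]
    intro x
    rw [Metric.continuousAt_iff']
    intro ε hε
    have hball : IsOpen (F ⁻¹' Metric.ball (F x) (ε / 4)) := Metric.isOpen_ball.preimage hF
    have hxb : x ∈ F ⁻¹' Metric.ball (F x) (ε / 4) := Metric.mem_ball_self (by linarith)
    have hb : ∀ z, z ∈ F ⁻¹' Metric.ball (F x) (ε / 4) → dist (F z) (F x) < ε / 4 :=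
      fun z hz => hz
    by_cases hxC : x ∈ C
    -- The crossing point `z` must also be mapped near `F x`, hence the connected neighbourhood. The
    -- errors add up to less than ε/2 + ε/4.
    · filter_upwards [(hball.connectedComponentIn (x := x)).mem_nhds
        (mem_connectedComponentIn hxb)] with y hy
      have hy' := hb y (connectedComponentIn_subset _ _ hy)
      rcases hG3 _ isPreconnected_connectedComponentIn y hy x (mem_connectedComponentIn hxb) with
        h | ⟨z, hz, -, h⟩
      · linarith
      · have hz' := hb z (connectedComponentIn_subset _ _ hz)
        rw [hG1 x hxC]
        have h1 := dist_triangle (G y) (F z) (F x)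
        have h2 := dist_triangle_right (F y) (F z) (F x)
        linarith
    · have hxO : x ∈ O x := mem_connectedComponentIn (F := Cᶜ) hxC
      filter_upwards [hball.mem_nhds hxb,
        (hCcl.isOpen_compl.connectedComponentIn (x := x)).mem_nhds hxO] with y hy hyO
      rcases hG3 _ isPreconnected_connectedComponentIn y hyO x hxO with h | ⟨z, hz, hzC, h⟩
      · have := hb y hy
        linarith
      · exact (connectedComponentIn_subset _ _ hz hzC).elim
  · by_cases hz : z ∈ C
    · rw [hG1 z hz]
      exact ⟨hFM z, hCsub hz⟩
    · rw [hG2 z hz]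
      exact hJM z ((hρ _ z hz rfl).2.1 _)

/-- A path that is homotopic in a closed set `M` to a path in a half-plane can be replaced by a
path in the half-plane that is not longer, and homotopic within the half-plane. -/
theorem HomotopicIn.exists_inter_halfPlane {M : Set Plane} (hM : IsClosed M) {u v : Plane}
    (hv : ‖v‖ = 1) (huv : ∀ x : Plane, x = inner ℝ u x • u + inner ℝ v x • v) (r : ℝ)
    {p c : Plane} {α β : Path p c} (h : HomotopicIn M β α) (hα : ∀ t, inner ℝ u (α t) ≤ r) :
    ∃ β' : Path p c, HomotopicIn (M ∩ {x | inner ℝ u x ≤ r}) β' α ∧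
      pathLength β' ≤ pathLength β := by
  obtain ⟨F, hFM⟩ := h
  -- Clamping both coordinates extends the homotopy from the square to the simply connected plane.
  let π : ℝ → I := Set.projIcc 0 1 zero_le_one
  have hπ : Continuous π := continuous_projIcc
  have hπI : ∀ t : I, π t = t := fun t => Set.projIcc_val _ t
  have hπ0 : π 0 = 0 := hπI 0
  have hπ1 : π 1 = 1 := hπI 1
  let F' : ℝ × ℝ → Plane := fun z => F (π z.1, π z.2)
  have hF' : Continuous F' := by fun_prop
  have hp : inner ℝ u p ≤ r := by simpa using hα 0
  have hc : inner ℝ u c ≤ r := by simpa using hα 1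
  set A := F' ⁻¹' {x | inner ℝ u x ≤ r} with hA
  have h1A : ∀ s : ℝ, ((1 : ℝ), s) ∈ A := fun s => by
    change inner ℝ u (F (π 1, π s)) ≤ r
    rw [hπ1, F.apply_one]
    exact hα _
  have hlA : ∀ s : ℝ, (s, (0 : ℝ)) ∈ A := fun s => by
    change inner ℝ u (F (π s, π 0)) ≤ r
    rw [hπ0, F.source]
    exact hp
  have hrA : ∀ s : ℝ, (s, (1 : ℝ)) ∈ A := fun s => by
    change inner ℝ u (F (π s, π 1)) ≤ r
    rw [hπ1, F.target]
    exact hc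
  obtain ⟨G, hG, hGF, hGM, hG3⟩ := exists_fold hM hv huv r hF' (fun z => hFM _)
    (isCompact_range F.continuous) (fun z => Set.mem_range_self _) (h1A 0) rfl
  rw [← hA] at hGF hG3
  -- The lines carrying the target path and the two fixed endpoints meet, so all three lie in `C`,
  -- where the fold changes nothing.
  have comp : ∀ (f : ℝ → ℝ × ℝ), Continuous f → (∀ t, f t ∈ A) →
      (∃ t, f t ∈ connectedComponentIn A (1, 0)) → ∀ t, f t ∈ connectedComponentIn A (1, 0) := by
    rintro f hf hfA ⟨t, ht⟩ s
    rw [connectedComponentIn_eq ht]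
    exact (isPreconnected_range hf).subset_connectedComponentIn ⟨t, rfl⟩
      (Set.range_subset_iff.2 hfA) ⟨s, rfl⟩
  have h1C := comp (fun s => (1, s)) (by fun_prop) h1A ⟨0, mem_connectedComponentIn (h1A 0)⟩
  have hlC := comp (fun s => (s, 0)) (by fun_prop) hlA ⟨1, h1C 0⟩
  have hrC := comp (fun s => (s, 1)) (by fun_prop) hrA ⟨1, h1C 1⟩
  have hG0 : ∀ t : ℝ, G (t, 0) = p := fun t => by
    rw [hGF _ (hlC t)]
    change F (π t, π 0) = p
    rw [hπ0, F.source]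
  have hG1 : ∀ t : ℝ, G (t, 1) = c := fun t => by
    rw [hGF _ (hrC t)]
    change F (π t, π 1) = c
    rw [hπ1, F.target]
  let β' : Path p c :=
    { toFun := fun s => G (0, s)
      continuous_toFun := by fun_prop
      source' := hG0 0
      target' := hG1 0 }
  refine ⟨β', ⟨{ toFun := fun z => G (z.1, z.2)
                 continuous_toFun := by fun_prop
                 map_zero_left := fun s => rfl
                 map_one_left := fun s => ?_
                 prop' := ?_ }, fun z => hGM _⟩, ?_⟩
  · change G (1, s) = α s
    rw [hGF _ (h1C s)]
    change F (π 1, π s) = α s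
    rw [hπ1, F.apply_one, hπI]
    rfl
  · rintro t s (rfl | rfl)
    · exact (hG0 t).trans (hG0 0).symm
    · exact (hG1 t).trans (hG1 0).symm
  · have hF0 : ∀ s : I, F' (0, s) = β s := fun s => by
      change F (π 0, π s) = β s
      rw [hπ0, F.apply_zero, hπI]
      rfl
    refine eVariationOn_le_of_edist_le fun s s' hss => ?_
    let f : I → ℝ × ℝ := fun t => (0, t)
    have hf : Continuous f := by fun_prop
    have hpre : ∀ a b : I, IsPreconnected (f '' Set.Icc a b) := fun a b =>
      isPreconnected_Icc.image _ hf.continuousOn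
    have he : ∀ {a b : I}, s ≤ a → a ≤ b → b ≤ s' →
        edist (β a) (β b) ≤ eVariationOn β (Set.Icc a b) := fun _ hab _ =>
      eVariationOn.edist_le _ ⟨le_rfl, hab⟩ ⟨hab, le_rfl⟩
    have conv : ∀ {a b c d : Plane}, dist a b ≤ dist c d → edist a b ≤ edist c d :=
      fun h => by simpa only [edist_dist] using ENNReal.ofReal_le_ofReal h
    have hadd : ∀ {a b c : I}, a ≤ b → b ≤ c → eVariationOn β (Set.Icc a b) +
        eVariationOn β (Set.Icc b c) = eVariationOn β (Set.Icc a c) := fun hab hbc => by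
      simpa using eVariationOn.Icc_add_Icc β (s := Set.univ) hab hbc (Set.mem_univ _)
    change edist (G (f s)) (G (f s')) ≤ _
    -- Unless the fold is already nonexpansive on the pair, `C` is met at some `a`; searching back
    -- from `s'` either bounds the rest directly or gives a second point `b`. The pieces are bounded
    -- by the variation of `β` and added.
    rcases hG3 _ (hpre s s') (f s) ⟨s, ⟨le_rfl, hss⟩, rfl⟩ (f s') ⟨s', ⟨hss, le_rfl⟩, rfl⟩ with
      h | ⟨_, ⟨a, ⟨hsa, has⟩, rfl⟩, haC, ha⟩
    · refine (conv h).trans ?_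
      rw [hF0, hF0]
      exact he le_rfl hss le_rfl
    · have ha' := conv ha
      rw [hF0, hF0] at ha'
      rw [← hadd hsa has]
      refine (edist_triangle _ (β a) _).trans (add_le_add (ha'.trans (he le_rfl hsa has)) ?_)
      rcases hG3 _ (hpre a s') (f s') ⟨s', ⟨has, le_rfl⟩, rfl⟩ (f a) ⟨a, ⟨le_rfl, has⟩, rfl⟩ with
        h | ⟨_, ⟨b, ⟨hab, hbs⟩, rfl⟩, hbC, hb⟩
      · have h' := conv h
        rw [hGF _ haC, hF0, hF0, edist_comm, edist_comm (β s')] at h'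
        exact h'.trans (he hsa has le_rfl)
      · have hb' := conv hb
        rw [hF0, hF0, edist_comm, edist_comm (β s')] at hb'
        rw [← hadd hab hbs]
        exact (edist_triangle _ (β b) _).trans
          (add_le_add (he hsa hab hbs) (hb'.trans (he (hsa.trans hab) hbs le_rfl)))

theorem eq_inner_smul_add_inner_smul {a b : Plane} (ha : ‖a‖ = 1) (hb : ‖b‖ = 1)
    (hab : inner ℝ a b = 0) (x : Plane) : x = inner ℝ a x • a + inner ℝ b x • b := by
  have hon : Orthonormal ℝ ![a, b] := by
    rw [orthonormal_vecCons_iff]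
    refine ⟨ha, fun i => ?_, ?_⟩
    · fin_cases i
      exact hab
    · rw [orthonormal_vecCons_iff]
      exact ⟨hb, fun i => i.elim0, ⟨fun i => i.elim0, fun i => i.elim0⟩⟩
  let B := (basisOfOrthonormalOfCardEqFinrank hon (by simp)).toOrthonormalBasis (by simpa using hon)
  have := B.sum_repr' x
  rw [Fin.sum_univ_two] at this
  simpa [B] using this.symm

/-! ### Edges are shortest in their homotopy class. -/

namespace Environment

variable {E : Environment} {p : Plane}

theorem isClosed_free : IsClosed E.free := by
  have : E.free = ⋂ o ∈ E.obstacles, {x | E.R ≤ dist x o} := by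
    ext x
    simp [free]
  rw [this]
  exact isClosed_biInter fun o _ => isClosed_le (by fun_prop) (by fun_prop)

/-- The edge of a corridor is a shortest path in its homotopy class, even though paths that leave
the corridor are taken into account. -/
theorem Corridor.pathLength_edge_le (C : E.Corridor p) {β : Path p C.crit}
    (h : HomotopicIn E.free β C.edge) : pathLength C.edge ≤ pathLength β := by
  have ha : ‖C.a‖ = 1 := C.far_ray.1
  have hb : ‖C.b‖ = 1 := C.norm_b
  have hab := C.inner_ab
  have hba : inner ℝ C.b C.a = 0 := by rw [real_inner_comm, hab]
  have haa : inner ℝ C.a C.a = 1 := by rw [real_inner_self_eq_norm_sq, ha, one_pow]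
  have hbb : inner ℝ C.b C.b = 1 := by rw [real_inner_self_eq_norm_sq, hb, one_pow]
  have dec := eq_inner_smul_add_inner_smul ha hb hab
  have dec' : ∀ x, x = inner ℝ C.b x • C.b + inner ℝ C.a x • C.a := fun x => by
    rw [add_comm]; exact dec x
  have decn : ∀ x, x = inner ℝ (-C.a) x • -C.a + inner ℝ C.b x • C.b := fun x => by
    rw [inner_neg_left, neg_smul_neg]; exact dec x
  have decn' : ∀ x, x = inner ℝ (-C.b) x • -C.b + inner ℝ C.a x • C.a := fun x => by
    rw [inner_neg_left, neg_smul_neg]; exact dec' x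
  have hedge : ∀ t, ∃ φ ∈ Set.Icc 0 C.near, ∃ ψ ∈ Set.Icc (-E.R) E.R,
      inner ℝ C.a (C.edge t) = inner ℝ C.a p + φ ∧
      inner ℝ C.b (C.edge t) = inner ℝ C.b p + ψ := fun t => by
    obtain ⟨-, φ, hφ, ψ, hψ, heq⟩ := C.edge_mem t
    refine ⟨φ, hφ, ψ, hψ, ?_, ?_⟩ <;> rw [heq] <;>
      simp only [inner_add_right, inner_smul_right, haa, hab, hba, hbb] <;> ring
  have hcl : ∀ {M : Set Plane} {u : Plane} {r : ℝ}, IsClosed M →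
      IsClosed (M ∩ {x | inner ℝ u x ≤ r}) := fun hM =>
    hM.inter (isClosed_le (by fun_prop) (by fun_prop))
  -- Each cut leaves a homotopy to the edge inside a smaller closed set, so the next cut preserves
  -- the earlier ones.
  obtain ⟨β₁, h₁, l₁⟩ := h.exists_inter_halfPlane isClosed_free hb dec (inner ℝ C.a p + C.near)
    fun t => by
      obtain ⟨φ, hφ, ψ, hψ, e1, e2⟩ := hedge t
      linarith [hφ.2]
  obtain ⟨β₂, h₂, l₂⟩ := h₁.exists_inter_halfPlane (hcl isClosed_free) hb decn (-inner ℝ C.a p)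
    fun t => by
      obtain ⟨φ, hφ, ψ, hψ, e1, e2⟩ := hedge t
      rw [inner_neg_left]
      linarith [hφ.1]
  obtain ⟨β₃, h₃, l₃⟩ := h₂.exists_inter_halfPlane (hcl (hcl isClosed_free)) ha dec'
    (inner ℝ C.b p + E.R)
    fun t => by
      obtain ⟨φ, hφ, ψ, hψ, e1, e2⟩ := hedge t
      linarith [hψ.2]
  obtain ⟨β₄, ⟨F, hF⟩, l₄⟩ := h₃.exists_inter_halfPlane (hcl (hcl (hcl isClosed_free))) ha decn'
    (E.R - inner ℝ C.b p)
    fun t => by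
      obtain ⟨φ, hφ, ψ, hψ, e1, e2⟩ := hedge t
      rw [inner_neg_left]
      linarith [hψ.1]
  refine (C.edge_shortest β₄ fun t => ?_).trans (l₄.trans (l₃.trans (l₂.trans l₁)))
  have := hF (0, t)
  rw [F.apply_zero] at this
  obtain ⟨⟨⟨⟨hf, i₁⟩, i₂⟩, i₃⟩, i₄⟩ := this
  simp only [Set.mem_ofPred_eq, inner_neg_left] at i₁ i₂ i₃ i₄
  change inner ℝ C.a (β₄ t) ≤ _ at i₁
  change -inner ℝ C.a (β₄ t) ≤ _ at i₂
  change inner ℝ C.b (β₄ t) ≤ _ at i₃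
  change -inner ℝ C.b (β₄ t) ≤ _ at i₄
  refine ⟨hf, inner ℝ C.a (β₄ t - p), ?_, inner ℝ C.b (β₄ t - p), ?_, ?_⟩
  · rw [inner_sub_right]
    constructor <;> linarith
  · rw [inner_sub_right]
    constructor <;> linarith
  · rw [add_assoc, ← dec]
    abel

end Environment

/-! ### Existence of shortest paths. -/

/-- A path of finite length has a Lipschitz reparametrization. -/
theorem Path.exists_lipschitz_reparam {x y : Plane} (γ : Path x y) {K : NNReal}
    (hK : pathLength γ ≤ K) :
    ∃ δ : Path x y, LipschitzWith K δ ∧ pathLength δ ≤ pathLength γ ∧ ∀ t, ∃ s, δ t = γ s := by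
  let V : I → ℝ≥0∞ := fun t => eVariationOn γ (Set.Iic t)
  have hV : ∀ {s t}, s ≤ t → V s + edist (γ s) (γ t) ≤ V t := fun {s t} hst => by
    have h1 : edist (γ s) (γ t) ≤ eVariationOn γ (Set.Icc s t) :=
      eVariationOn.edist_le _ ⟨le_rfl, hst⟩ ⟨hst, le_rfl⟩
    have h2 : V s + eVariationOn γ (Set.Icc s t) ≤ eVariationOn γ (Set.Iic s ∪ Set.Icc s t) :=
      eVariationOn.add_le_union _ fun a ha b hb => le_trans ha hb.1
    exact ((add_le_add le_rfl h1).trans h2).trans (eVariationOn.mono _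
      (Set.union_subset (Set.Iic_subset_Iic.2 hst) Set.Icc_subset_Iic_self))
  have hV0 : V 0 = 0 := eVariationOn.subsingleton _ fun a ha b hb =>
    (le_antisymm (b := (0 : I)) ha a.2.1).trans (le_antisymm (b := (0 : I)) hb b.2.1).symm
  let A : I → Set I := fun v => {t | V t ≤ K * ENNReal.ofReal v}
  have hA0 : ∀ v, 0 ∈ A v := fun v => by simp [A, hV0]
  have hbdd : ∀ v, BddAbove (A v) := fun v => ⟨1, fun t _ => t.2.2⟩
  have hdown : ∀ v {s t}, s ≤ t → t ∈ A v → s ∈ A v := fun v s t hst ht =>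
    (le_self_add.trans (hV hst)).trans ht
  let τ : I → I := fun v => sSup (A v)
  have hτmono : Monotone τ := fun v w hvw => csSup_le_csSup (hbdd w) ⟨0, hA0 v⟩ fun t ht =>
    (show V t ≤ K * ENNReal.ofReal v from ht).trans (by gcongr)
  have hτcl : ∀ v, τ v ∈ closure (A v) := fun v => csSup_mem_closure ⟨0, hA0 v⟩ (hbdd v)
  have hτge : ∀ {v t}, t ∈ A v → t ≤ τ v := fun {v t} ht => le_csSup (hbdd v) ht
  have hτlt : ∀ {v t}, t < τ v → t ∈ A v := fun {v t} ht => by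
    obtain ⟨t', ht', htt⟩ := exists_lt_of_lt_csSup ⟨0, hA0 v⟩ ht
    exact hdown v htt.le ht'
  clear_value τ
  -- Continuity of `V` is not needed: just right of `τ v` it is at least `K * v`, and just left of
  -- `τ w` at most `K * w`. The bound passes to the ends by continuity of `γ`.
  have hlip' : ∀ v w : I, v ≤ w → edist (γ (τ v)) (γ (τ w)) ≤ K * edist v w := by
    intro v w hvw
    rcases (hτmono hvw).eq_or_lt with h | h
    · simp [h]
    obtain ⟨m, hm1, hm2⟩ := exists_between h
    have hclosed : IsClosed {z : I × I | edist (γ z.1) (γ z.2) ≤ K * edist v w} :=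
      isClosed_le (by fun_prop) continuous_const
    have hsub : Set.Ioo (τ v) m ×ˢ Set.Ioo m (τ w) ⊆
        {z : I × I | edist (γ z.1) (γ z.2) ≤ K * edist v w} := by
      rintro ⟨s, t⟩ ⟨hs, ht⟩
      have hs' : K * ENNReal.ofReal v ≤ V s := le_of_not_ge fun h' =>
        hs.1.not_ge (hτge h')
      have ht' : V t ≤ K * ENNReal.ofReal w := hτlt ht.2
      have h1 := hV (hs.2.trans ht.1).le
      have h2 : (K : ℝ≥0∞) * ENNReal.ofReal w = K * ENNReal.ofReal v + K * edist v w := by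
        have hvw' : (0 : ℝ) ≤ w - v := sub_nonneg.2 hvw
        rw [← mul_add, edist_comm, Subtype.edist_eq, edist_dist, Real.dist_eq,
          abs_of_nonneg hvw', ← ENNReal.ofReal_add v.2.1 hvw']
        congr 2
        ring
      have h3 : K * ENNReal.ofReal v + edist (γ s) (γ t) ≤
          K * ENNReal.ofReal v + K * edist v w :=
        ((add_le_add hs' le_rfl).trans (h1.trans ht')).trans h2.le
      exact (ENNReal.add_le_add_iff_left
        (ENNReal.mul_ne_top ENNReal.coe_ne_top ENNReal.ofReal_ne_top)).1 h3
    have hmem : (τ v, τ w) ∈ closure (Set.Ioo (τ v) m ×ˢ Set.Ioo m (τ w)) := by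
      rw [closure_prod_eq, closure_Ioo hm1.ne, closure_Ioo hm2.ne]
      exact Set.mk_mem_prod (Set.left_mem_Icc.2 hm1.le) (Set.right_mem_Icc.2 hm2.le)
    have hT : (τ v, τ w) ∈ {z : I × I | edist (γ z.1) (γ z.2) ≤ K * edist v w} := by
      refine closure_minimal ?_ ?_ hmem
      · exact hsub
      · exact hclosed
    rwa [Set.mem_ofPred_eq] at hT
  have hlip : LipschitzWith K fun v => γ (τ v) := fun v w => by
    rcases le_total v w with h | h
    · exact hlip' v w h
    · rw [edist_comm, edist_comm v]
      exact hlip' w v h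
  refine ⟨⟨⟨_, hlip.continuous⟩, ?_, ?_⟩, hlip, ?_, fun t => ⟨τ t, rfl⟩⟩
  · change γ (τ 0) = x
    have hclosed : IsClosed {t | γ t = x} := isClosed_eq γ.continuous continuous_const
    refine hclosed.closure_subset_iff.2 (fun t ht => ?_) (hτcl 0)
    have h1 := hV (show (0 : I) ≤ t from t.2.1)
    have h2 : V t ≤ 0 := by simpa [A] using ht
    rw [hV0, zero_add, γ.source] at h1
    exact (edist_le_zero.1 (h1.trans h2)).symm
  · change γ (τ 1) = y
    have h1 : (1 : I) ∈ A 1 := by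
      change V 1 ≤ _
      simpa using (eVariationOn.mono γ (Set.subset_univ _)).trans hK
    have : τ 1 = 1 := le_antisymm (τ 1).2.2 (hτge h1)
    rw [this, γ.target]
  · exact eVariationOn.comp_le_of_monotoneOn _ _ (hτmono.monotoneOn _) fun _ _ => Set.mem_univ _

/-- In a closed set, two points that are joined by a path of finite length are joined by a
shortest path. -/
theorem exists_shortest_path {M : Set Plane} (hM : IsClosed M) {x y : Plane} (γ : Path x y)
    (hγ : ∀ t, γ t ∈ M) (hfin : pathLength γ ≠ ⊤) :
    ∃ γ₀ : Path x y, (∀ t, γ₀ t ∈ M) ∧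
      ∀ δ : Path x y, (∀ t, δ t ∈ M) → pathLength γ₀ ≤ pathLength δ := by
  lift pathLength γ to NNReal using hfin with K hK
  let S : Set (I → Plane) := {f | (∀ s t, edist (f s) (f t) ≤ K * edist s t) ∧ f 0 = x ∧ f 1 = y ∧
    ∀ t, f t ∈ M}
  -- Compactness is that of the product topology (Tychonoff); variation is lower semicontinuous for
  -- pointwise convergence.
  have hS : IsCompact S := by
    have h1 : IsClosed {f : I → Plane | ∀ s t, edist (f s) (f t) ≤ K * edist s t} := by
      rw [show {f : I → Plane | ∀ s t, edist (f s) (f t) ≤ K * edist s t} =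
        ⋂ (s) (t), {f | edist (f s) (f t) ≤ K * edist s t} by
          ext; simp only [Set.mem_iInter, Set.mem_ofPred_eq]]
      exact isClosed_iInter fun s => isClosed_iInter fun t =>
        isClosed_le (by fun_prop) continuous_const
    have h2 : IsClosed {f : I → Plane | ∀ t, f t ∈ M} := by
      rw [show {f : I → Plane | ∀ t, f t ∈ M} = ⋂ t, {f | f t ∈ M} by
        ext; simp only [Set.mem_iInter, Set.mem_ofPred_eq]]
      exact isClosed_iInter fun t => hM.preimage (continuous_apply t)
    have h3 : IsClosed {f : I → Plane | f 0 = x} := isClosed_eq (by fun_prop) continuous_const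
    have h4 : IsClosed {f : I → Plane | f 1 = y} := isClosed_eq (by fun_prop) continuous_const
    refine (isCompact_univ_pi fun _ : I => isCompact_closedBall x K).of_isClosed_subset
      (h1.inter (h3.inter (h4.inter h2))) ?_
    rintro f ⟨hf, hf0, -⟩ t -
    have hl : LipschitzWith K f := hf
    have := hl.dist_le_mul t 0
    rw [hf0] at this
    refine Metric.mem_closedBall.2 (this.trans (mul_le_of_le_one_right K.2 ?_))
    rw [Subtype.dist_eq, Real.dist_eq]
    simpa [abs_of_nonneg t.2.1] using t.2.2
  have hlsc : LowerSemicontinuous fun f : I → Plane => eVariationOn f Set.univ := fun f v hv =>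
    eVariationOn.lowerSemicontinuous_aux (F := fun g : I → Plane => g) (p := nhds f)
      (fun t _ => (continuous_apply t).tendsto f) hv
  have key : ∀ δ : Path x y, (∀ t, δ t ∈ M) → pathLength δ ≤ K →
      ∃ f ∈ S, eVariationOn f Set.univ ≤ pathLength δ := by
    intro δ hδ hδK
    obtain ⟨δ', h1, h2, h3⟩ := δ.exists_lipschitz_reparam hδK
    refine ⟨δ', ⟨h1, δ'.source, δ'.target, fun t => ?_⟩, h2⟩
    obtain ⟨s, hs⟩ := h3 t
    exact hs ▸ hδ s
  obtain ⟨f₁, hf₁, hf₁K⟩ := key γ hγ hK.ge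
  obtain ⟨f, ⟨hf, hf0, hf1, hfM⟩, hmin⟩ := (hlsc.lowerSemicontinuousOn S).exists_isMinOn
    ⟨f₁, hf₁⟩ hS
  have hl : LipschitzWith K f := hf
  refine ⟨⟨⟨f, hl.continuous⟩, hf0, hf1⟩, hfM, fun δ hδ => ?_⟩
  rcases le_total (pathLength δ) K with h | h
  · obtain ⟨g, hg, hgδ⟩ := key δ hδ h
    exact (hmin hg).trans hgδ
  · exact (hmin hf₁).trans (hf₁K.trans (hK.ge.trans h))

/-! ### Cancellation of homotopies, and additivity of length. -/

theorem Path.Homotopic.of_cast {X : Type*} [TopologicalSpace X] {x y x' y' : X} {γ δ : Path x y}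
    (h : γ.Homotopic δ) (hx : x' = x) (hy : y' = y) :
    (γ.cast hx hy).Homotopic (δ.cast hx hy) := by
  subst hx hy
  exact h

theorem Path.subpath_trans_homotopic {X : Type*} [TopologicalSpace X] {x y z : X} (γ : Path x z)
    (t : I) (h : γ t = y) :
    (((γ.subpath 0 t).cast γ.source.symm h.symm).trans
      ((γ.subpath t 1).cast h.symm γ.target.symm)).Homotopic γ := by
  have h1 : ((γ.subpath 0 t).trans (γ.subpath t 1)).Homotopic (γ.subpath 0 1) :=
    ⟨Path.Homotopy.subpathTransSubpath γ 0 t 1⟩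
  have h2 := h1.of_cast γ.source.symm γ.target.symm
  rw [γ.subpath_zero_one] at h2
  subst h
  exact h2

theorem Path.Homotopic.trans_left_cancel {X : Type*} [TopologicalSpace X] {x y z : X}
    {a a' : Path x y} {b b' : Path y z} (h : (a.trans b).Homotopic (a'.trans b'))
    (ha : a.Homotopic a') : b.Homotopic b' := by
  have key : ∀ c : Path y z, (a.symm.trans (a.trans c)).Homotopic c := fun c =>
    (Path.Homotopic.symm ⟨Path.Homotopy.transAssoc a.symm a c⟩).trans
      ((Path.Homotopic.hcomp (Path.Homotopic.symm ⟨Path.Homotopy.reflSymmTrans a⟩)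
        (Path.Homotopic.refl c)).trans ⟨Path.Homotopy.reflTrans c⟩)
  have h2 : (a.trans b).Homotopic (a.trans b') :=
    h.trans (Path.Homotopic.hcomp ha.symm (Path.Homotopic.refl b'))
  exact (key b).symm.trans ((Path.Homotopic.hcomp (Path.Homotopic.refl _) h2).trans (key b'))

/-- A path in a set, as a path in the subspace. -/
def Path.restrictTo {X : Type*} [TopologicalSpace X] {x y : X} (γ : Path x y) (M : Set X)
    (h : ∀ t, γ t ∈ M) (hx : x ∈ M) (hy : y ∈ M) : Path (⟨x, hx⟩ : M) ⟨y, hy⟩ where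
  toFun t := ⟨γ t, h t⟩
  continuous_toFun := by fun_prop
  source' := Subtype.ext γ.source
  target' := Subtype.ext γ.target

theorem Path.trans_mem {X : Type*} [TopologicalSpace X] {M : Set X} {x y z : X} {γ : Path x y} {δ : Path y z}
    (hγ : ∀ t, γ t ∈ M) (hδ : ∀ t, δ t ∈ M) (t : I) : γ.trans δ t ∈ M := by
  have ht : γ.trans δ t ∈ Set.range (γ.trans δ) := ⟨t, rfl⟩
  rw [Path.trans_range] at ht
  rcases ht with ⟨_, h⟩ | ⟨_, h⟩
  · exact h ▸ hγ _
  · exact h ▸ hδ _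

namespace HomotopicIn

variable {M : Set Plane} {x y z : Plane}

theorem refl {γ : Path x y} (h : ∀ t, γ t ∈ M) : HomotopicIn M γ γ :=
  ⟨Path.Homotopy.refl γ, fun w => h w.2⟩

theorem mem_left {γ δ : Path x y} (h : HomotopicIn M γ δ) (t : I) : γ t ∈ M := by
  obtain ⟨F, hF⟩ := h
  have := hF (0, t)
  rwa [F.apply_zero] at this

theorem mem_right {γ δ : Path x y} (h : HomotopicIn M γ δ) (t : I) : δ t ∈ M := by
  obtain ⟨F, hF⟩ := h
  have := hF (1, t)
  rwa [F.apply_one] at this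

theorem restrictTo {γ δ : Path x y} (h : HomotopicIn M γ δ) (hx : x ∈ M) (hy : y ∈ M) :
    (γ.restrictTo M h.mem_left hx hy).Homotopic (δ.restrictTo M h.mem_right hx hy) := by
  obtain ⟨F, hF⟩ := h
  exact ⟨{ toFun := fun w => ⟨F w, hF w⟩
           continuous_toFun := by fun_prop
           map_zero_left := fun t => Subtype.ext (F.apply_zero t)
           map_one_left := fun t => Subtype.ext (F.apply_one t)
           prop' := fun t s hs => Subtype.ext (F.prop' t s hs) }⟩

theorem of_restrictTo {γ δ : Path x y} {hγ : ∀ t, γ t ∈ M} {hδ : ∀ t, δ t ∈ M} {hx : x ∈ M}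
    {hy : y ∈ M} (h : (γ.restrictTo M hγ hx hy).Homotopic (δ.restrictTo M hδ hx hy)) :
    HomotopicIn M γ δ := by
  obtain ⟨F⟩ := h
  exact ⟨{ toFun := fun w => F w
           continuous_toFun := by fun_prop
           map_zero_left := fun t => congrArg Subtype.val (F.apply_zero t)
           map_one_left := fun t => congrArg Subtype.val (F.apply_one t)
           prop' := fun t s hs => congrArg Subtype.val (F.prop' t s hs) }, fun w => (F w).2⟩

/-- This is left cancellation in the fundamental groupoid of the subspace `M`; it isolates the last
edge of a tree path. -/
theorem subpath_of_trans {γ : Path x z} {a : Path x y} {b : Path y z} {t : I} (h : γ t = y)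
    (hγ : HomotopicIn M γ (a.trans b))
    (ha : HomotopicIn M ((γ.subpath 0 t).cast γ.source.symm h.symm) a) :
    HomotopicIn M ((γ.subpath t 1).cast h.symm γ.target.symm) b := by
  have hm := hγ.mem_left
  have hx : x ∈ M := γ.source ▸ hm 0
  have hy : y ∈ M := h ▸ hm t
  have hz : z ∈ M := γ.target ▸ hm 1
  have hb : ∀ s, b s ∈ M := fun s => by
    obtain ⟨s', hs'⟩ : b s ∈ Set.range (a.trans b) := by
      rw [Path.trans_range]; exact Or.inr ⟨s, rfl⟩
    exact hs' ▸ hγ.mem_right s'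
  let γ' := γ.restrictTo M hm hx hz
  have ht : γ' t = ⟨y, hy⟩ := Subtype.ext h
  have e : (a.trans b).restrictTo M hγ.mem_right hx hz =
      (a.restrictTo M ha.mem_right hx hy).trans (b.restrictTo M hb hy hz) := by
    ext s
    simp only [Path.restrictTo, Path.trans_apply, Path.coe_mk_mk]
    split_ifs <;> rfl
  have h1 : (((γ'.subpath 0 t).cast γ'.source.symm ht.symm).trans
      ((γ'.subpath t 1).cast ht.symm γ'.target.symm)).Homotopic
      ((a.restrictTo M ha.mem_right hx hy).trans (b.restrictTo M hb hy hz)) :=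
    (γ'.subpath_trans_homotopic t ht).trans (e ▸ hγ.restrictTo hx hz)
  have h2 := h1.trans_left_cancel (ha.restrictTo hx hy)
  exact of_restrictTo (γ := (γ.subpath t 1).cast h.symm γ.target.symm) (hγ := fun s => hm _)
    (hδ := hb) (hx := hy) (hy := hz) h2

end HomotopicIn

theorem pathLength_subpath {x y : Plane} (γ : Path x y) {s t : I} (h : s ≤ t) :
    pathLength (γ.subpath s t) = eVariationOn γ (Set.Icc s t) := by
  have hmono : Monotone (Set.Icc.convexComb s t) := fun a b hab => by
    rw [← Subtype.coe_le_coe] at h hab ⊢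
    simp only [Set.Icc.coe_convexComb]
    nlinarith
  have := eVariationOn.comp_eq_of_monotoneOn (γ : I → Plane) (t := Set.univ)
    (Set.Icc.convexComb s t) (hmono.monotoneOn _)
  rw [Set.image_univ, Path.range_subpathAux, Set.uIcc_of_le h] at this
  exact this

theorem pathLength_eq_add {x y : Plane} (γ : Path x y) (t : I) :
    pathLength γ = pathLength (γ.subpath 0 t) + pathLength (γ.subpath t 1) := by
  rw [pathLength_subpath γ (s := 0) t.2.1, pathLength_subpath γ (t := 1) t.2.2]
  have := eVariationOn.Icc_add_Icc γ (s := Set.univ) (a := 0) (b := t) (c := 1) t.2.1 t.2.2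
    (Set.mem_univ _)
  simp only [Set.univ_inter] at this
  rw [this, pathLength]
  congr 1
  exact (Set.eq_univ_of_forall fun s => Set.mem_Icc.2 ⟨s.2.1, s.2.2⟩).symm

theorem pathLengthUpTo_eq {x y : Plane} (γ : Path x y) (t : I) :
    pathLengthUpTo γ t = pathLength (γ.subpath 0 t) := by
  rw [pathLength_subpath γ (s := 0) t.2.1, pathLengthUpTo]
  congr 1
  ext s
  exact ⟨fun h => ⟨s.2.1, h⟩, fun h => h.2⟩

/-- The midpoint of the unit interval. -/
noncomputable def unitInterval.mid : I := ⟨1 / 2, by norm_num, by norm_num⟩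

theorem Path.trans_mid {X : Type*} [TopologicalSpace X] {x y z : X} (γ : Path x y)
    (δ : Path y z) : γ.trans δ unitInterval.mid = y := by
  simp [Path.trans_apply, unitInterval.mid]

theorem Path.subpath_trans_left {X : Type*} [TopologicalSpace X] {x y z : X} (γ : Path x y)
    (δ : Path y z) : ((γ.trans δ).subpath 0 unitInterval.mid).cast (γ.trans δ).source.symm
      (γ.trans_mid δ).symm = γ := by
  ext s
  have hs := s.2.2
  have h1 : ((Set.Icc.convexComb 0 unitInterval.mid s : I) : ℝ) = s / 2 := by
    simp [unitInterval.mid, div_eq_mul_inv]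
  change γ.trans δ (Set.Icc.convexComb 0 unitInterval.mid s) = γ s
  rw [Path.trans_apply, dif_pos (by rw [h1]; linarith)]
  congr 1
  ext
  simp only [h1]
  ring

theorem Path.subpath_trans_right {X : Type*} [TopologicalSpace X] {x y z : X} (γ : Path x y)
    (δ : Path y z) : ((γ.trans δ).subpath unitInterval.mid 1).cast (γ.trans_mid δ).symm
      (γ.trans δ).target.symm = δ := by
  ext s
  have h1 : ((Set.Icc.convexComb unitInterval.mid 1 s : I) : ℝ) = (1 + s) / 2 := by
    simp only [Set.Icc.coe_convexComb, unitInterval.mid, Set.Icc.coe_one]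
    ring
  change γ.trans δ (Set.Icc.convexComb unitInterval.mid 1 s) = δ s
  rw [Path.trans_apply]
  split_ifs with h
  -- Only the junction falls into the first branch, and there both paths have the same value.
  · have hs : s = 0 := le_antisymm (Subtype.coe_le_coe.1 (by
      rw [h1] at h; change (s : ℝ) ≤ 0; linarith)) s.2.1
    have hδ : δ s = γ 1 := by rw [hs, δ.source, γ.target]
    rw [hδ]
    congr 1
    ext
    norm_num [hs, unitInterval.mid]
  · congr 1
    ext
    simp only [h1]
    ring

theorem pathLength_trans {x y z : Plane} (γ : Path x y) (δ : Path y z) :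
    pathLength (γ.trans δ) = pathLength γ + pathLength δ := by
  rw [pathLength_eq_add _ unitInterval.mid]
  congr 1
  · conv_rhs => rw [← γ.subpath_trans_left δ]
    rfl
  · conv_rhs => rw [← γ.subpath_trans_right δ]
    rfl

theorem edist_le_pathLength {x y : Plane} (γ : Path x y) : edist x y ≤ pathLength γ := by
  have := eVariationOn.edist_le γ (Set.mem_univ (0 : I)) (Set.mem_univ 1)
  rwa [γ.source, γ.target] at this

theorem exists_path_of_segment_subset {M : Set Plane} {x y : Plane} (h : segment ℝ x y ⊆ M) :
    ∃ γ : Path x y, (∀ t, γ t ∈ M) ∧ pathLength γ ≤ edist x y := by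
  let γ : Path x y :=
    { toFun := fun t => AffineMap.lineMap x y (t : ℝ)
      continuous_toFun := by fun_prop
      source' := by simp
      target' := by simp }
  refine ⟨γ, fun t => h ?_, ?_⟩
  · rw [segment_eq_image_lineMap]
    exact ⟨t, t.2, rfl⟩
  · have h1 := (lipschitzWith_lineMap (𝕜 := ℝ) x y).lipschitzOnWith (s := Set.univ)
      |>.comp_eVariationOn_le (g := fun t : I => (t : ℝ)) (s := Set.univ) (fun _ _ => Set.mem_univ _)
    have h2 := MonotoneOn.eVariationOn_eq (f := fun t : I => (t : ℝ)) (s := Set.univ)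
      (fun _ _ _ _ h => h) (Set.mem_univ 0) (Set.mem_univ 1)
    have h3 : (Set.univ : Set I) ∩ Set.Icc 0 1 = Set.univ := by
      rw [Set.univ_inter]
      exact Set.eq_univ_of_forall fun s => ⟨s.2.1, s.2.2⟩
    rw [h3] at h2
    refine h1.trans ((mul_le_mul_right h2.le _).trans ?_)
    rw [edist_nndist]
    simp

/-! ### Minimal lengths in the distinguished homotopies. -/

namespace Environment

variable {E : Environment} {s p : Plane}

theorem Gap.exists_path_of_mem_sweeper (G : E.Gap p) {m : Plane} (hm : m ∈ G.sweeper) :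
    (∃ γ : Path G.crit m, (∀ t, γ t ∈ E.free) ∧ pathLength γ ≤ edist G.crit m) ∧
      ∃ γ : Path m G.crit, (∀ t, γ t ∈ E.free) ∧ pathLength γ ≤ edist m G.crit := by
  obtain ⟨φ, hφ, rfl, hfree⟩ := hm
  have hseg : segment ℝ G.crit (p + φ • G.a + E.R • G.b) ⊆ E.free := by
    rw [segment_eq_image_lineMap]
    rintro _ ⟨t, ht, rfl⟩
    have : AffineMap.lineMap G.crit (p + φ • G.a + E.R • G.b) t =
        p + (G.near + t * (φ - G.near)) • G.a + E.R • G.b := by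
      rw [AffineMap.lineMap_apply_module, Gap.crit]
      module
    rw [this]
    apply hfree
    have := hφ.1
    constructor <;> nlinarith [ht.1, ht.2]
  exact ⟨exists_path_of_segment_subset hseg, exists_path_of_segment_subset
    (segment_symm ℝ G.crit _ ▸ hseg)⟩

namespace Node

theorem g_root : (root : Node E s s).g = 0 :=
  eVariationOn.constant_on (by
    rintro _ ⟨a, -, rfl⟩ _ ⟨b, -, rfl⟩
    rfl)

theorem g_child (n : Node E s p) (C : E.Corridor p) :
    (n.child C).g = n.g + pathLength C.edge := pathLength_trans _ _

theorem g_ne_top : ∀ {p : Plane} (n : Node E s p), n.g ≠ ⊤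
  | _, root => by
    rw [g_root]
    exact ENNReal.zero_ne_top
  | _, child n C => by
    rw [g_child]
    exact ENNReal.add_ne_top.2 ⟨n.g_ne_top, C.edge_finite⟩

theorem free_of_mem_paths : ∀ {p : Plane} (n : Node E s p) {x : Plane} {γ : Path s x},
    γ ∈ n.paths x → ∀ t, γ t ∈ E.free
  | _, root, _, _, h => h
  | _, child _ _, _, _, h => h.1

/-- The tree path, continued by a collision-free path, belongs to the distinguished homotopy. -/
theorem treePath_trans_mem_paths : ∀ {p : Plane} (n : Node E s p) {x : Plane} (δ : Path p x),
    (∀ t, δ t ∈ E.free) → n.treePath.trans δ ∈ n.paths x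
  | _, root, _, δ, hδ => by
    exact Path.trans_mem (fun _ => δ.source ▸ hδ 0) hδ
  | _, child n C, _, δ, hδ => by
    have ih := n.treePath_trans_mem_paths C.edge fun t => (C.edge_mem t).1
    have hfree := n.free_of_mem_paths ih
    have e := (n.treePath.trans C.edge).subpath_trans_left δ
    refine ⟨Path.trans_mem hfree hδ, unitInterval.mid, Path.trans_mid _ _, ?_, ?_⟩
    · change HomotopicIn _ ((((n.treePath.trans C.edge).trans δ).subpath 0 _).cast _ _) _
      rw [e]
      exact HomotopicIn.refl hfree
    · change ((((n.treePath.trans C.edge).trans δ).subpath 0 _).cast _ _) ∈ _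
      rw [e]
      exact ih

/-- The part of a path in the distinguished homotopy up to some visit of the point of the tree is
homotopic to the tree path, and not shorter than it. -/
theorem exists_prefix : ∀ {p : Plane} (n : Node E s p) {x : Plane} {γ : Path s x},
    γ ∈ n.paths x → ∃ (t : I) (h : γ t = p),
      HomotopicIn E.free ((γ.subpath 0 t).cast γ.source.symm h.symm) n.treePath ∧
      n.g ≤ pathLength (γ.subpath 0 t)
  | _, root, x, γ, hγ => by
    refine ⟨0, γ.source, ?_, ?_⟩
    · have : (γ.subpath 0 0).cast γ.source.symm γ.source.symm = Path.refl s := by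
        ext t
        simp
      rw [this]
      exact HomotopicIn.refl fun _ => γ.source ▸ hγ 0
    · rw [g_root]
      exact zero_le
  | _, child n C, x, γ, hγ => by
    obtain ⟨-, t, h, hhom, hmem⟩ := hγ
    refine ⟨t, h, hhom, ?_⟩
    -- The part up to the critical point passes through the source point at `t'`. What follows `t'`
    -- is homotopic to the edge, hence at least as long.
    obtain ⟨t', h', hhom', hle⟩ := n.exists_prefix hmem
    have hedge := C.pathLength_edge_le (HomotopicIn.subpath_of_trans h' hhom hhom')
    rw [g_child]
    have := pathLength_eq_add ((γ.subpath 0 t).cast γ.source.symm h.symm) t'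
    exact (add_le_add hle hedge).trans this.ge

/-- The minimal length in a distinguished homotopy exists, and it is attained by a path that
continues the tree path. -/
theorem exists_isLeast (n : Node E s p) {x : Plane} (δ : Path p x) (hδ : ∀ t, δ t ∈ E.free)
    (hfin : pathLength δ ≠ ⊤) : ∃ δ₀ : Path p x, pathLength δ₀ ≤ pathLength δ ∧
      IsLeast (pathLength '' n.paths x) (n.g + pathLength δ₀) := by
  obtain ⟨δ₀, hδ₀, hmin⟩ := exists_shortest_path isClosed_free δ hδ hfin
  refine ⟨δ₀, hmin δ hδ, ⟨_, n.treePath_trans_mem_paths δ₀ hδ₀, pathLength_trans _ _⟩, ?_⟩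
  rintro _ ⟨γ, hγ, rfl⟩
  obtain ⟨t, h, -, hle⟩ := n.exists_prefix hγ
  rw [pathLength_eq_add γ t]
  exact add_le_add hle (hmin ((γ.subpath t 1).cast h.symm γ.target.symm) fun _ =>
    n.free_of_mem_paths hγ _)

theorem exists_isLeast_of_mem_sweeper (n : Node E s p) (C : E.Corridor p) {m : Plane}
    (hm : m ∈ C.sweeper) : ∃ L, (n.child C).g + edist C.crit m ≤ L ∧
      IsLeast (pathLength '' (n.child C).paths m) L := by
  obtain ⟨⟨δ, hδ, hlen⟩, -⟩ := C.exists_path_of_mem_sweeper hm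
  obtain ⟨δ₀, -, hleast⟩ := (n.child C).exists_isLeast δ hδ
    (ne_top_of_le_ne_top (edist_ne_top _ _) hlen)
  exact ⟨_, add_le_add le_rfl (edist_le_pathLength δ₀), hleast⟩

/-- A node beats the node of a corridor at a point of the gap sweeper if it has a short enough
continuation to this point. -/
theorem beats_child (n' : Node E s p) (C : E.Corridor p) {m : Plane} (hm : m ∈ C.sweeper)
    {p' : Plane} (n : Node E s p') (δ : Path p' m) (hδ : ∀ t, δ t ∈ E.free)
    (hlt : n.g + pathLength δ < (n'.child C).g + edist C.crit m) :
    n.Beats (n'.child C) m := by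
  obtain ⟨L', hL', hleast'⟩ := n'.exists_isLeast_of_mem_sweeper C hm
  obtain ⟨δ₀, hδ₀, hleast⟩ := n.exists_isLeast δ hδ fun h => by simp [h] at hlt
  exact ⟨_, L', hleast, hleast', ((add_le_add le_rfl hδ₀).trans_lt hlt).trans_le hL'⟩

end Node

end Environment

theorem mainTheorem10 (E : Environment) (pStart : Plane) {p_i p_j : Plane}
    (i : E.Node pStart p_i) (j : E.Node pStart p_j)
    (k : E.Corridor p_i) (l : E.Corridor p_j)
    (q : Plane) (hqs : q ∈ l.sweeper) (t : unitInterval) (hqt : k.edge t = q) :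
    ((j.child l).g + edist l.crit q < i.g + pathLengthUpTo k.edge t →
      ∀ m ∈ k.sweeper, (j.child l).Beats (i.child k) m) ∧
    (i.g + pathLengthUpTo k.edge t + edist q l.crit < (j.child l).g →
      ∀ m ∈ l.sweeper, i.Beats (j.child l) m) := by
  obtain ⟨⟨σ₁, hσ₁, lσ₁⟩, σ₂, hσ₂, lσ₂⟩ := l.exists_path_of_mem_sweeper hqs
  rw [pathLengthUpTo_eq]
  have hedge := pathLength_eq_add k.edge t
  have hk : ∀ u, k.edge u ∈ E.free := fun u => (k.edge_mem u).1
  let α₁ : Path p_i q := (k.edge.subpath 0 t).cast k.edge.source.symm hqt.symm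
  let α₂ : Path q k.crit := (k.edge.subpath t 1).cast hqt.symm k.edge.target.symm
  change pathLength k.edge = pathLength α₁ + pathLength α₂ at hedge
  change (_ < _ + pathLength α₁ → _) ∧ (_ + pathLength α₁ + _ < _ → _)
  have hα₁ : ∀ u, α₁ u ∈ E.free := fun u => hk _
  have hα₂ : ∀ u, α₂ u ∈ E.free := fun u => hk _
  have hfin : pathLength α₂ ≠ ⊤ :=
    ne_top_of_le_ne_top k.edge_finite (hedge ▸ le_add_self)
  constructor
  · intro hlt m hm
    obtain ⟨⟨ν, hν, lν⟩, -⟩ := k.exists_path_of_mem_sweeper hm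
    -- The detour goes back along the sweeper to `q`, then along the rest of the edge and on to `m`.
    -- Its tail from `q` has the length bound that appears in the competitor; finiteness of that
    -- bound keeps the inequality strict.
    refine i.beats_child k hm _ (σ₁.trans (α₂.trans ν))
      (Path.trans_mem hσ₁ (Path.trans_mem hα₂ hν)) ?_
    rw [pathLength_trans, pathLength_trans, i.g_child, hedge]
    calc (j.child l).g + (pathLength σ₁ + (pathLength α₂ + pathLength ν))
        ≤ (j.child l).g + (edist l.crit q + (pathLength α₂ + edist k.crit m)) := by gcongr
      _ = (j.child l).g + edist l.crit q + (pathLength α₂ + edist k.crit m) := by ring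
      _ < i.g + pathLength α₁ + (pathLength α₂ + edist k.crit m) :=
        ENNReal.add_lt_add_right (ENNReal.add_ne_top.2 ⟨hfin, edist_ne_top _ _⟩) hlt
      _ = _ := by ring
  · intro hlt m hm
    obtain ⟨⟨ν, hν, lν⟩, -⟩ := l.exists_path_of_mem_sweeper hm
    -- Here the detour follows the edge to `q` and the sweeper line to the critical point of `l`,
    -- then continues to `m`.
    refine j.beats_child l hm _ (α₁.trans (σ₂.trans ν))
      (Path.trans_mem hα₁ (Path.trans_mem hσ₂ hν)) ?_
    rw [pathLength_trans, pathLength_trans]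
    calc i.g + (pathLength α₁ + (pathLength σ₂ + pathLength ν))
        ≤ i.g + (pathLength α₁ + (edist q l.crit + edist l.crit m)) := by gcongr
      _ = i.g + pathLength α₁ + edist q l.crit + edist l.crit m := by ring
      _ < _ := ENNReal.add_lt_add_right (edist_ne_top _ _) hlt
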